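/- Let $\ell$ be an odd prime. In $\mathrm{GL}_2(\mathbb{F}_\ell)$ let $\mathcal{C}_s$ be the group of invertible diagonal matrices, $\mathcal{C}_s^+ = \mathcal{C}_s \cup \begin{pmatrix} 0 & 1 \\ 1 & 0 \end{pmatrix}\mathcal{C}_s$, $\mathcal{C}_{ns} = \left\{\begin{pmatrix} a & \varepsilon b \\ b & a \end{pmatrix} : a, b \in \mathbb{F}_\ell,\ (a,b) \neq (0,0)\right\}$ for a fixed non-square $\varepsilon \in \mathbb{F}_\ell^\times$ (arbitrarily chosen), and $\mathcal{B}$ the group of invertible upper triangular matrices. For a subgroup $G \subseteq \mathrm{GL}_2(\mathbb{F}_\ell)$, let $\overline{G}$ be its image in $\mathrm{PGL}_2(\mathbb{F}_\ell)$, and let $$\mathcal{F}_1(G) = \frac{\left|\{\gamma \in G : 1 \text{ is an eigenvalue of } \gamma\}\right|}{|G|}.$$ We say that $G$ is - of type $Cs$ if $\ell \nmid |G|$ and $G$ is conjugate in $\mathrm{GL}_2(\mathbb{F}_\ell)$ to a subgroup of $\mathcal{C}_s$; - of type $Ns$ if $\ell \nmid |G|$ and $G$ is conjugate to a subgroup of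 $\mathcal{C}_s^+$, but not to a subgroup of $\mathcal{C}_s$ or of $\mathcal{C}_{ns}$; - of type $B$ if $\ell \mid |G|$ and $G$ is conjugate to a subgroup of $\mathcal{B}$, but not to a subgroup of $\mathcal{C}_s$; - of type $A_4$, $S_4$ or $A_5$ if $\ell \nmid |G|$ and $\overline{G}$ is isomorphic to the alternating group $A_4$, the symmetric group $S_4$ or the alternating group $A_5$, respectively. Let $G \subseteq \mathrm{GL}_2(\mathbb{F}_\ell)$ be a subgroup with $\mathcal{F}_1(G) \neq 1$. Then $$\mathcal{F}_1(G) \leq \begin{cases} \frac12 + \frac{1}{|G|} & \text{if } G \text{ is of type } Cs \text{ or } Ns, \\ \frac12 + \frac{\ell}{|G|} & \text{if } G \text{ is of type } B, \\ \frac34 & \text{if } G \text{ is of type } A_4,\ S_4 \text{ or } A_5. \end{cases}$$ Moreover, for every subgroup $G \subseteq \mathrm{GL}_2(\mathbb{F}_\ell)$, of any of these types or of none, $\mathcal{F}_1(G) \neq 1$ implies $\mathcal{F}_1(G) \leq \frac34$. -/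

import Mathlib

namespace EigOne

open Matrix

/-- The group `GL₂(𝔽_ℓ)`. -/
abbrev GL2 (ℓ : ℕ) : Type := GL (Fin 2) (ZMod ℓ)

/-- The split Cartan subgroup: the invertible diagonal matrices. -/
def splitCartan (ℓ : ℕ) : Subgroup (GL2 ℓ) where
  carrier := {g | ∃ a d : ZMod ℓ, (g : Matrix (Fin 2) (Fin 2) (ZMod ℓ)) = !![a, 0; 0, d]}
  mul_mem' := by
    rintro x y ⟨a, d, hx⟩ ⟨a', d', hy⟩
    exact ⟨a * a', d * d', by simp [hx, hy]⟩
  one_mem' := ⟨1, 1, by simp [Matrix.one_fin_two]⟩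
  inv_mem' := by
    rintro x ⟨a, d, hx⟩
    refine ⟨Ring.inverse x.1.det * d, Ring.inverse x.1.det * a, ?_⟩
    rw [Matrix.coe_units_inv, Matrix.inv_def, hx, Matrix.adjugate_fin_two_of]
    simp

/-- The normalizer of the split Cartan subgroup: the invertible matrices that are diagonal or
antidiagonal, i.e. the union of the split Cartan subgroup and of its coset of
`!![0, 1; 1, 0]`. -/
def splitCartanNormalizer (ℓ : ℕ) : Subgroup (GL2 ℓ) where
  carrier := {g | (∃ a d : ZMod ℓ, (g : Matrix (Fin 2) (Fin 2) (ZMod ℓ)) = !![a, 0; 0, d]) ∨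
    ∃ b c : ZMod ℓ, (g : Matrix (Fin 2) (Fin 2) (ZMod ℓ)) = !![0, b; c, 0]}
  mul_mem' := by
    rintro x y (⟨a, d, hx⟩ | ⟨a, d, hx⟩) (⟨a', d', hy⟩ | ⟨a', d', hy⟩)
    · exact Or.inl ⟨a * a', d * d', by simp [hx, hy]⟩
    · exact Or.inr ⟨a * a', d * d', by simp [hx, hy]⟩
    · exact Or.inr ⟨a * d', d * a', by simp [hx, hy]⟩
    · exact Or.inl ⟨a * d', d * a', by simp [hx, hy]⟩
  one_mem' := Or.inl ⟨1, 1, by simp [Matrix.one_fin_two]⟩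
  inv_mem' := by
    rintro x (⟨a, d, hx⟩ | ⟨b, c, hx⟩)
    · refine Or.inl ⟨Ring.inverse x.1.det * d, Ring.inverse x.1.det * a, ?_⟩
      rw [Matrix.coe_units_inv, Matrix.inv_def, hx, Matrix.adjugate_fin_two_of]
      simp
    · refine Or.inr ⟨Ring.inverse x.1.det * (-b), Ring.inverse x.1.det * (-c), ?_⟩
      rw [Matrix.coe_units_inv, Matrix.inv_def, hx, Matrix.adjugate_fin_two_of]
      simp

/-- The non-split Cartan subgroup attached to `ε`, to be used for a non-square `ε`: the invertible
matrices of the form `!![a, ε * b; b, a]`. -/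
def nonsplitCartan (ℓ : ℕ) (ε : ZMod ℓ) : Subgroup (GL2 ℓ) where
  carrier := {g | ∃ a b : ZMod ℓ, (g : Matrix (Fin 2) (Fin 2) (ZMod ℓ)) = !![a, ε * b; b, a]}
  mul_mem' := by
    rintro x y ⟨a, b, hx⟩ ⟨a', b', hy⟩
    refine ⟨a * a' + ε * b * b', b * a' + a * b', ?_⟩
    rw [Units.val_mul, hx, hy, Matrix.mul_fin_two]
    congr! 3 <;> ring_nf
  one_mem' := ⟨1, 0, by simp [Matrix.one_fin_two]⟩
  inv_mem' := by
    rintro x ⟨a, b, hx⟩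
    refine ⟨Ring.inverse x.1.det * a, Ring.inverse x.1.det * (-b), ?_⟩
    rw [Matrix.coe_units_inv, Matrix.inv_def, hx, Matrix.adjugate_fin_two_of]
    simp [mul_left_comm]

/-- The Borel subgroup: the invertible upper triangular matrices. -/
def borel (ℓ : ℕ) : Subgroup (GL2 ℓ) where
  carrier := {g | ∃ a b d : ZMod ℓ, (g : Matrix (Fin 2) (Fin 2) (ZMod ℓ)) = !![a, b; 0, d]}
  mul_mem' := by
    rintro x y ⟨a, b, d, hx⟩ ⟨a', b', d', hy⟩
    exact ⟨a * a', a * b' + b * d', d * d', by simp [hx, hy]⟩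
  one_mem' := ⟨1, 0, 1, by simp [Matrix.one_fin_two]⟩
  inv_mem' := by
    rintro x ⟨a, b, d, hx⟩
    refine ⟨Ring.inverse x.1.det * d, Ring.inverse x.1.det * (-b), Ring.inverse x.1.det * a, ?_⟩
    rw [Matrix.coe_units_inv, Matrix.inv_def, hx, Matrix.adjugate_fin_two_of]
    simp

/-- `G` is conjugate to a subgroup of `H`. -/
def ConjInto {ℓ : ℕ} (G H : Subgroup (GL2 ℓ)) : Prop :=
  ∃ g : GL2 ℓ, G.map (MulAut.conj g).toMonoidHom ≤ H

/-- The image of `G` in `PGL₂(𝔽_ℓ)`, the quotient of `GL₂(𝔽_ℓ)` by its center. -/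
def projImage {ℓ : ℕ} (G : Subgroup (GL2 ℓ)) :
    Subgroup (ProjGenLinGroup (Fin 2) (ZMod ℓ)) :=
  G.map ProjGenLinGroup.mk

/-- Type `Cs`. -/
def IsTypeCs {ℓ : ℕ} (G : Subgroup (GL2 ℓ)) : Prop :=
  ¬ ℓ ∣ Nat.card G ∧ ConjInto G (splitCartan ℓ)

/-- Type `Ns`, with respect to a non-square `ε`. -/
def IsTypeNs {ℓ : ℕ} (ε : ZMod ℓ) (G : Subgroup (GL2 ℓ)) : Prop :=
  ¬ ℓ ∣ Nat.card G ∧ ConjInto G (splitCartanNormalizer ℓ) ∧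
    ¬ ConjInto G (splitCartan ℓ) ∧ ¬ ConjInto G (nonsplitCartan ℓ ε)

/-- Type `B`. -/
def IsTypeB {ℓ : ℕ} (G : Subgroup (GL2 ℓ)) : Prop :=
  ℓ ∣ Nat.card G ∧ ConjInto G (borel ℓ) ∧ ¬ ConjInto G (splitCartan ℓ)

/-- Type `A₄`. -/
def IsTypeA4 {ℓ : ℕ} (G : Subgroup (GL2 ℓ)) : Prop :=
  ¬ ℓ ∣ Nat.card G ∧ Nonempty (projImage G ≃* alternatingGroup (Fin 4))

/-- Type `S₄`. -/
def IsTypeS4 {ℓ : ℕ} (G : Subgroup (GL2 ℓ)) : Prop :=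
  ¬ ℓ ∣ Nat.card G ∧ Nonempty (projImage G ≃* Equiv.Perm (Fin 4))

/-- Type `A₅`. -/
def IsTypeA5 {ℓ : ℕ} (G : Subgroup (GL2 ℓ)) : Prop :=
  ¬ ℓ ∣ Nat.card G ∧ Nonempty (projImage G ≃* alternatingGroup (Fin 5))

/-- The set of matrices in `GL₂(𝔽_ℓ)` that have `1` as an eigenvalue. -/
def eigOneSet (ℓ : ℕ) : Set (GL2 ℓ) :=
  {γ | Module.End.HasEigenvalue
    (Matrix.toLin' (γ : Matrix (Fin 2) (Fin 2) (ZMod ℓ))) (1 : ZMod ℓ)}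

/-- The proportion of elements of `G` that have `1` as an eigenvalue. -/
noncomputable def F1 {ℓ : ℕ} (G : Subgroup (GL2 ℓ)) : ℚ :=
  (Nat.card ((G : Set (GL2 ℓ)) ∩ eigOneSet ℓ : Set (GL2 ℓ)) : ℚ) / (Nat.card G : ℚ)

end EigOne

/-! A matrix has eigenvalue 1 iff its trace is 1 + det. Let X be the set of such elements of G.

If G is upper triangular, X is the union of the kernels A, D of the two diagonal characters, and
|A||D| ≤ |G||A ∩ D| bounds that union (`ncard_union_le`). The intersection is unipotent, of order at
most ℓ, and trivial when G is diagonal. For the split normalizer, the antidiagonal part of X has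
determinant -1, so it is counted by a third subgroup of the diagonal part.

The bound 3/4 needs no classification of subgroups. It depends on the determinant-one subgroup S of
G. If S is trivial, G is abelian, and is either triangularizable or has X inside {1}. If S is
nontrivial without unipotents other than 1, a trace identity for translates of X applies
(`ncard_eigOne_of_semisimple`). If S has a nontrivial unipotent, either G fixes its line, or -1 ∈ G
and X is compared with -X (`ncard_eigOne_of_neg_one_mem`). -/

namespace EigOne

open Matrix

/-! ### Counting in finite groups -/

section FiniteGroup

variable {Γ : Type*} [Group Γ]

theorem card_mul_relIndex_of_le {H K : Subgroup Γ} (h : H ≤ K) :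
    Nat.card H * H.relIndex K = Nat.card K := by
  rw [← Subgroup.relIndex_bot_left, ← Subgroup.relIndex_bot_left]
  exact Subgroup.relIndex_mul_relIndex _ _ _ bot_le h

variable [Finite Γ]

/-- The product set AD has |A||D| / |A ∩ D| elements and lies in K; in index form, D has at most as
many cosets meeting A as it has in K. -/
theorem card_mul_card_le {A D K : Subgroup Γ} (hA : A ≤ K) (hD : D ≤ K) :
    Nat.card A * Nat.card D ≤ Nat.card K * Nat.card (A ⊓ D : Subgroup Γ) := by
  have h₁ := card_mul_relIndex_of_le (inf_le_left : A ⊓ D ≤ A)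
  have h₂ := card_mul_relIndex_of_le hD
  rw [Subgroup.inf_relIndex_left] at h₁
  have h₃ : D.relIndex A ≤ D.relIndex K := Subgroup.relIndex_le_of_le_right hA
    fun h => by rw [h, mul_zero] at h₂; exact Nat.card_pos.ne h₂
  rw [← h₁, ← h₂]
  calc _ = Nat.card (A ⊓ D : Subgroup Γ) * Nat.card D * D.relIndex A := by ring
    _ ≤ Nat.card (A ⊓ D : Subgroup Γ) * Nat.card D * D.relIndex K := by gcongr
    _ = _ := by ring

theorem two_mul_card_le_of_not_le {H K : Subgroup Γ} (h : H ≤ K) (hK : ¬ K ≤ H) :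
    2 * Nat.card H ≤ Nat.card K := by
  have h₁ := card_mul_relIndex_of_le h
  have h₂ : H.relIndex K ≠ 1 := fun e => hK (Subgroup.relIndex_eq_one.1 e)
  have h₃ : H.relIndex K ≠ 0 := fun e => by
    rw [e, mul_zero] at h₁; exact Nat.card_pos.ne h₁
  rw [← h₁, mul_comm]
  gcongr
  omega

theorem ncard_union_add_card_inf (A D : Subgroup Γ) :
    (A ∪ D : Set Γ).ncard + Nat.card (A ⊓ D : Subgroup Γ) = Nat.card A + Nat.card D :=
  Set.ncard_union_add_ncard_inter (A : Set Γ) (D : Set Γ)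

/-- A union of two subgroups that is not the whole finite group covers at most half of the group
up to the size of the intersection, and at most three quarters of the group. -/
theorem ncard_union_le {A D K : Subgroup Γ} (hA : A ≤ K) (hD : D ≤ K)
    (hne : (A ∪ D : Set Γ) ≠ K) :
    2 * (A ∪ D : Set Γ).ncard ≤ Nat.card K + 2 * Nat.card (A ⊓ D : Subgroup Γ) ∧
      4 * (A ∪ D : Set Γ).ncard ≤ 3 * Nat.card K := by
  have hu := ncard_union_add_card_inf A D
  have hm := card_mul_card_le hA hD
  have hn : 0 < Nat.card (A ⊓ D : Subgroup Γ) := Nat.card_pos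
  by_cases h₁ : A ≤ D
  · have hKD : ¬ K ≤ D := fun h => hne (by
      rw [Set.union_eq_self_of_subset_left (show (A : Set Γ) ⊆ D from h₁), le_antisymm hD h])
    have := two_mul_card_le_of_not_le hD hKD
    rw [inf_eq_left.2 h₁] at hu ⊢
    constructor <;> omega
  by_cases h₂ : D ≤ A
  · have hKA : ¬ K ≤ A := fun h => hne (by
      rw [Set.union_eq_self_of_subset_right (show (D : Set Γ) ⊆ A from h₂), le_antisymm hA h])
    have := two_mul_card_le_of_not_le hA hKA
    rw [inf_eq_right.2 h₂] at hu ⊢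
    constructor <;> omega
  have ha := two_mul_card_le_of_not_le (inf_le_left : A ⊓ D ≤ A) fun h => h₁ (h.trans inf_le_right)
  have hd := two_mul_card_le_of_not_le (inf_le_right : A ⊓ D ≤ D) fun h => h₂ (h.trans inf_le_left)
  generalize Nat.card (A ⊓ D : Subgroup Γ) = n at *
  generalize Nat.card A = a at *
  generalize Nat.card D = d at *
  generalize Nat.card K = k at *
  -- With |A| = 2n + a and |D| = 2n + d, the product bound nk ≥ |A||D| gives k ≥ 4n + 2a + 2d, while
  -- the union has 3n + a + d elements.
  obtain ⟨a, rfl⟩ := Nat.exists_eq_add_of_le ha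
  obtain ⟨d, rfl⟩ := Nat.exists_eq_add_of_le hd
  have hk : 4 * n + 2 * a + 2 * d ≤ k := by
    refine Nat.le_of_mul_le_mul_right (le_trans ?_ hm) hn
    nlinarith [Nat.zero_le (a * d)]
  constructor <;> omega

theorem lt_ncard_inter {α : Type*} [Finite α] {K S T : Set α} {p q : ℕ} (hS : S ⊆ K) (hT : T ⊆ K)
    (h : K.ncard + q < S.ncard + p) (hp : p ≤ T.ncard) : q < (S ∩ T).ncard := by
  have h₁ := Set.ncard_inter_add_ncard_union S T
  have h₂ : (S ∪ T).ncard ≤ K.ncard := Set.ncard_le_ncard (Set.union_subset hS hT)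
  omega

end FiniteGroup

/-! ### Eigenvalue 1 and invariance under conjugation -/

variable {ℓ : ℕ}

/-- The elements of `G` that have `1` as an eigenvalue. -/
def eigOne (G : Subgroup (GL2 ℓ)) : Set (GL2 ℓ) := (G : Set (GL2 ℓ)) ∩ eigOneSet ℓ

theorem F1_eq (G : Subgroup (GL2 ℓ)) : F1 G = ((eigOne G).ncard : ℚ) / (Nat.card G : ℚ) := rfl

theorem card_map_conj (G : Subgroup (GL2 ℓ)) (g : GL2 ℓ) :
    Nat.card (G.map (MulAut.conj g).toMonoidHom) = Nat.card G :=
  Subgroup.card_map_of_injective (MulAut.conj g).injective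

theorem trace_conj (g γ : GL2 ℓ) :
    ((g * γ * g⁻¹ : GL2 ℓ) : Matrix (Fin 2) (Fin 2) (ZMod ℓ)).trace =
      (γ : Matrix (Fin 2) (Fin 2) (ZMod ℓ)).trace := by
  rw [Units.val_mul, Matrix.trace_mul_comm, ← Units.val_mul, inv_mul_cancel_left]

theorem det_conj (g γ : GL2 ℓ) :
    ((g * γ * g⁻¹ : GL2 ℓ) : Matrix (Fin 2) (Fin 2) (ZMod ℓ)).det =
      (γ : Matrix (Fin 2) (Fin 2) (ZMod ℓ)).det := by
  rw [Units.val_mul, Matrix.det_mul_comm, ← Units.val_mul, inv_mul_cancel_left]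

theorem ext_entries {g h : GL2 ℓ} (h₀₀ : g 0 0 = h 0 0) (h₀₁ : g 0 1 = h 0 1)
    (h₁₀ : g 1 0 = h 1 0) (h₁₁ : g 1 1 = h 1 1) : g = h := by
  ext i j
  fin_cases i <;> fin_cases j <;> assumption

variable [Fact ℓ.Prime]

/-- The characteristic polynomial at 1 is 1 - tr + det. -/
theorem mem_eigOneSet_iff {γ : GL2 ℓ} :
    γ ∈ eigOneSet ℓ ↔ (γ : Matrix (Fin 2) (Fin 2) (ZMod ℓ)).trace =
      1 + (γ : Matrix (Fin 2) (Fin 2) (ZMod ℓ)).det := by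
  rw [eigOneSet, Set.mem_ofPred_eq, Module.End.hasEigenvalue_iff_isRoot_charpoly, charpoly_toLin',
    charpoly_fin_two, Polynomial.IsRoot]
  simp only [Polynomial.eval_add, Polynomial.eval_sub, Polynomial.eval_pow, Polynomial.eval_X,
    Polynomial.eval_mul, Polynomial.eval_C]
  constructor <;> intro h <;> linear_combination -h

theorem mem_eigOne {G : Subgroup (GL2 ℓ)} {γ : GL2 ℓ} :
    γ ∈ eigOne G ↔ γ ∈ G ∧ (γ : Matrix (Fin 2) (Fin 2) (ZMod ℓ)).trace =
      1 + (γ : Matrix (Fin 2) (Fin 2) (ZMod ℓ)).det :=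
  and_congr_right fun _ => mem_eigOneSet_iff

theorem card_pos' (G : Subgroup (GL2 ℓ)) : (0 : ℚ) < Nat.card G := by
  exact_mod_cast Nat.card_pos

theorem F1_ne_one_iff {G : Subgroup (GL2 ℓ)} : F1 G ≠ 1 ↔ eigOne G ≠ G := by
  rw [F1_eq, Ne, div_eq_one_iff_eq (card_pos' G).ne', Nat.cast_inj, not_iff_not]
  refine ⟨fun h => Set.eq_of_subset_of_ncard_le Set.inter_subset_left h.ge, fun h => ?_⟩
  rw [h]
  rfl

theorem F1_le_three_quarters_iff {G : Subgroup (GL2 ℓ)} :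
    F1 G ≤ 3 / 4 ↔ 4 * (eigOne G).ncard ≤ 3 * Nat.card G := by
  rw [F1_eq, div_le_iff₀ (card_pos' G), ← @Nat.cast_le ℚ]
  push_cast
  constructor <;> intro h <;> linarith

theorem F1_le_half_add {G : Subgroup (GL2 ℓ)} {k : ℕ}
    (h : 2 * (eigOne G).ncard ≤ Nat.card G + 2 * k) :
    F1 G ≤ 1 / 2 + (k : ℚ) / (Nat.card G : ℚ) := by
  have hG := card_pos' G
  rw [F1_eq, div_le_iff₀ hG, add_mul, div_mul_cancel₀ _ hG.ne']
  have : (2 * (eigOne G).ncard : ℚ) ≤ Nat.card G + 2 * k := by exact_mod_cast h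
  linarith

theorem eigOne_map_conj (G : Subgroup (GL2 ℓ)) (g : GL2 ℓ) :
    eigOne (G.map (MulAut.conj g).toMonoidHom) = MulAut.conj g '' eigOne G := by
  ext γ
  simp only [mem_eigOne, Subgroup.mem_map, Set.mem_image]
  constructor
  · rintro ⟨⟨x, hx, rfl⟩, h⟩
    refine ⟨x, ⟨hx, ?_⟩, rfl⟩
    simpa only [MulEquiv.coe_toMonoidHom, MulAut.conj_apply, trace_conj, det_conj] using h
  · rintro ⟨x, ⟨hx, h⟩, rfl⟩
    refine ⟨⟨x, hx, rfl⟩, ?_⟩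
    simpa only [MulAut.conj_apply, trace_conj, det_conj] using h

theorem F1_map_conj (G : Subgroup (GL2 ℓ)) (g : GL2 ℓ) :
    F1 (G.map (MulAut.conj g).toMonoidHom) = F1 G := by
  rw [F1_eq, F1_eq, card_map_conj, eigOne_map_conj,
    Set.ncard_image_of_injective _ (MulAut.conj g).injective]

/-! ### Triangular and diagonal subgroups -/

theorem mem_borel_iff {g : GL2 ℓ} : g ∈ borel ℓ ↔ g 1 0 = 0 := by
  constructor
  · rintro ⟨a, b, d, h⟩
    simp [h]
  · intro h
    refine ⟨g 0 0, g 0 1, g 1 1, ?_⟩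
    rw [← h]
    exact eta_fin_two _

theorem mem_splitCartan_iff {g : GL2 ℓ} : g ∈ splitCartan ℓ ↔ g 0 1 = 0 ∧ g 1 0 = 0 := by
  constructor
  · rintro ⟨a, d, h⟩
    simp [h]
  · rintro ⟨h₁, h₂⟩
    refine ⟨g 0 0, g 1 1, ?_⟩
    conv_lhs => rw [eta_fin_two (g : Matrix (Fin 2) (Fin 2) (ZMod ℓ)), h₁, h₂]

theorem splitCartan_le_borel : splitCartan ℓ ≤ borel ℓ := fun _ h =>
  mem_borel_iff.2 (mem_splitCartan_iff.1 h).2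

theorem det_eq (g : GL2 ℓ) :
    (g : Matrix (Fin 2) (Fin 2) (ZMod ℓ)).det = g 0 0 * g 1 1 - g 0 1 * g 1 0 :=
  det_fin_two _

theorem det_ne_zero' (g : GL2 ℓ) : (g : Matrix (Fin 2) (Fin 2) (ZMod ℓ)).det ≠ 0 :=
  ((Matrix.isUnit_iff_isUnit_det _).1 g.isUnit).ne_zero

/-- A diagonal entry, as a character of the Borel subgroup. -/
def borelEntry (i : Fin 2) : borel ℓ →* ZMod ℓ where
  toFun g := (g : GL2 ℓ) i i
  map_one' := by simp
  map_mul' x y := by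
    have hx := mem_borel_iff.1 x.2
    have hy := mem_borel_iff.1 y.2
    fin_cases i <;> simp [Matrix.mul_apply, Fin.sum_univ_two, hx, hy]

/-- The upper triangular matrices whose `i`-th diagonal entry is `1`. -/
def borelKer (ℓ : ℕ) [Fact ℓ.Prime] (i : Fin 2) : Subgroup (GL2 ℓ) :=
  (borelEntry (ℓ := ℓ) i).ker.map (borel ℓ).subtype

theorem mem_borelKer_iff {i : Fin 2} {g : GL2 ℓ} : g ∈ borelKer ℓ i ↔ g 1 0 = 0 ∧ g i i = 1 := by
  constructor
  · rintro ⟨x, hx, rfl⟩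
    exact ⟨mem_borel_iff.1 x.2, hx⟩
  · rintro ⟨h₁, h₂⟩
    exact ⟨⟨g, mem_borel_iff.2 h₁⟩, h₂, rfl⟩

theorem mem_eigOneSet_of_borel {g : GL2 ℓ} (h : g 1 0 = 0) :
    g ∈ eigOneSet ℓ ↔ g 0 0 = 1 ∨ g 1 1 = 1 := by
  rw [mem_eigOneSet_iff, det_eq, trace_fin_two, h, ← sub_eq_zero (a := g 0 0),
    ← sub_eq_zero (a := g 1 1), ← mul_eq_zero]
  constructor <;> intro h <;> linear_combination -h

theorem eigOne_of_le_borel {G : Subgroup (GL2 ℓ)} (hG : G ≤ borel ℓ) :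
    eigOne G = ((G ⊓ borelKer ℓ 0 : Subgroup (GL2 ℓ)) ∪ (G ⊓ borelKer ℓ 1 : Subgroup (GL2 ℓ)) :
      Set (GL2 ℓ)) := by
  ext g
  simp only [eigOne, Set.mem_inter_iff, Set.mem_union, SetLike.mem_coe, Subgroup.mem_inf,
    mem_borelKer_iff, ← and_or_left]
  refine and_congr_right fun hg => ?_
  have h := mem_borel_iff.1 (hG hg)
  simp [mem_eigOneSet_of_borel h, h]

theorem ncard_eigOne_of_le_borel {G : Subgroup (GL2 ℓ)} (hG : G ≤ borel ℓ) (h : F1 G ≠ 1) :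
    2 * (eigOne G).ncard ≤ Nat.card G +
        2 * Nat.card (G ⊓ borelKer ℓ 0 ⊓ (G ⊓ borelKer ℓ 1) : Subgroup (GL2 ℓ)) ∧
      4 * (eigOne G).ncard ≤ 3 * Nat.card G := by
  rw [F1_ne_one_iff] at h
  rw [eigOne_of_le_borel hG] at h ⊢
  exact ncard_union_le inf_le_left inf_le_left h

theorem card_borelKer_inf_le (G : Subgroup (GL2 ℓ)) :
    Nat.card (G ⊓ borelKer ℓ 0 ⊓ (G ⊓ borelKer ℓ 1) : Subgroup (GL2 ℓ)) ≤ ℓ := by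
  let f : (G ⊓ borelKer ℓ 0 ⊓ (G ⊓ borelKer ℓ 1) : Subgroup (GL2 ℓ)) → ZMod ℓ := fun g => g.1 0 1
  have hf : Function.Injective f := by
    rintro ⟨x, hx⟩ ⟨y, hy⟩ h
    simp only [Subgroup.mem_inf, mem_borelKer_iff] at hx hy
    exact Subtype.ext (ext_entries (by rw [hx.1.2.2, hy.1.2.2]) h (by rw [hx.1.2.1, hy.1.2.1])
      (by rw [hx.2.2.2, hy.2.2.2]))
  simpa using Nat.card_le_card_of_injective f hf

theorem card_borelKer_inf_of_splitCartan {G : Subgroup (GL2 ℓ)} (hG : G ≤ splitCartan ℓ) :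
    Nat.card (G ⊓ borelKer ℓ 0 ⊓ (G ⊓ borelKer ℓ 1) : Subgroup (GL2 ℓ)) = 1 := by
  rw [Subgroup.card_eq_one, eq_bot_iff]
  intro x hx
  simp only [Subgroup.mem_inf, mem_borelKer_iff] at hx
  have h := mem_splitCartan_iff.1 (hG hx.1.1)
  exact Subgroup.mem_bot.2 (ext_entries (by simp [hx.1.2.2]) (by simp [h.1]) (by simp [h.2])
    (by simp [hx.2.2.2]))

theorem F1_le_of_conjInto_borel {G : Subgroup (GL2 ℓ)} (hG : ConjInto G (borel ℓ))
    (h : F1 G ≠ 1) : F1 G ≤ 1 / 2 + (ℓ : ℚ) / (Nat.card G : ℚ) ∧ F1 G ≤ 3 / 4 := by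
  obtain ⟨g, hg⟩ := hG
  rw [← F1_map_conj G g] at h ⊢
  rw [← card_map_conj G g]
  have := ncard_eigOne_of_le_borel hg h
  have hc := card_borelKer_inf_le (G.map (MulAut.conj g).toMonoidHom)
  exact ⟨F1_le_half_add (by omega), F1_le_three_quarters_iff.2 this.2⟩

theorem F1_le_of_conjInto_splitCartan {G : Subgroup (GL2 ℓ)} (hG : ConjInto G (splitCartan ℓ))
    (h : F1 G ≠ 1) : F1 G ≤ 1 / 2 + 1 / (Nat.card G : ℚ) := by
  obtain ⟨g, hg⟩ := hG
  rw [← F1_map_conj G g] at h ⊢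
  rw [← card_map_conj G g]
  have := ncard_eigOne_of_le_borel (hg.trans splitCartan_le_borel) h
  rw [card_borelKer_inf_of_splitCartan hg] at this
  exact_mod_cast F1_le_half_add this.1

/-! ### The normalizer of the split Cartan -/

theorem det_eq_neg_one_of_antidiagonal {g : GL2 ℓ} (hg : g ∈ splitCartanNormalizer ℓ)
    (hg' : g ∉ splitCartan ℓ) (h : g ∈ eigOneSet ℓ) : GeneralLinearGroup.det g = -1 := by
  rcases hg with hg | ⟨b, c, hbc⟩
  · exact absurd hg hg'
  rw [mem_eigOneSet_iff, trace_fin_two] at h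
  ext
  simp only [GeneralLinearGroup.val_det_apply, Units.val_neg, Units.val_one]
  simp only [hbc] at h ⊢
  simp at h ⊢
  linear_combination h

theorem mul_mem_splitCartan_of_antidiagonal {g h : GL2 ℓ} (hg : g ∈ splitCartanNormalizer ℓ)
    (hg' : g ∉ splitCartan ℓ) (hh : h ∈ splitCartanNormalizer ℓ) (hh' : h ∉ splitCartan ℓ) :
    g * h ∈ splitCartan ℓ := by
  rcases hg with hg | ⟨b, c, hg⟩
  · exact absurd hg hg'
  rcases hh with hh | ⟨b', c', hh⟩
  · exact absurd hh hh'
  exact ⟨b * c', c * b', by simp [hg, hh]⟩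

/-- The diagonal part H has index at least 2, so it suffices to find at most |H| + 1 elements with
eigenvalue 1. Three subgroups of H meeting pairwise trivially account for them: A and D (one
diagonal entry equal to 1) and S (determinant 1). -/
theorem ncard_eigOne_of_le_splitCartanNormalizer {G : Subgroup (GL2 ℓ)}
    (hG : G ≤ splitCartanNormalizer ℓ) (hG' : ¬ G ≤ splitCartan ℓ) :
    2 * (eigOne G).ncard ≤ Nat.card G + 2 := by
  set H := G ⊓ splitCartan ℓ with hH
  have hHG : 2 * Nat.card H ≤ Nat.card G :=
    two_mul_card_le_of_not_le inf_le_left fun h => hG' (h.trans inf_le_right)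
  set A := H ⊓ borelKer ℓ 0 with hA
  set D := H ⊓ borelKer ℓ 1 with hD
  set S := H ⊓ (GeneralLinearGroup.det (n := Fin 2) (R := ZMod ℓ)).ker with hS
  have entries : ∀ {x}, x ∈ S → x 0 1 = 0 ∧ x 1 0 = 0 ∧ x 0 0 * x 1 1 = 1 := by
    intro x hx
    obtain ⟨⟨-, h₁⟩, h₂⟩ := hx
    obtain ⟨h₃, h₄⟩ := mem_splitCartan_iff.1 h₁
    have h₅ := congrArg Units.val (MonoidHom.mem_ker.1 h₂)
    rw [GeneralLinearGroup.val_det_apply, det_eq, h₃] at h₅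
    exact ⟨h₃, h₄, by simpa using h₅⟩
  have hAD : Nat.card (A ⊓ D : Subgroup (GL2 ℓ)) = 1 :=
    card_borelKer_inf_of_splitCartan inf_le_right
  have hAS : Nat.card (A ⊓ S : Subgroup (GL2 ℓ)) = 1 := by
    rw [Subgroup.card_eq_one, eq_bot_iff]
    rintro x ⟨⟨-, h₁⟩, h₂⟩
    obtain ⟨h₃, h₄, h₅⟩ := entries h₂
    have h₆ := (mem_borelKer_iff.1 h₁).2
    rw [h₆, one_mul] at h₅
    exact Subgroup.mem_bot.2 (ext_entries (by simp [h₆]) (by simp [h₃]) (by simp [h₄])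
      (by simp [h₅]))
  have hDS : Nat.card (D ⊓ S : Subgroup (GL2 ℓ)) = 1 := by
    rw [Subgroup.card_eq_one, eq_bot_iff]
    rintro x ⟨⟨-, h₁⟩, h₂⟩
    obtain ⟨h₃, h₄, h₅⟩ := entries h₂
    have h₆ := (mem_borelKer_iff.1 h₁).2
    rw [h₆, mul_one] at h₅
    exact Subgroup.mem_bot.2 (ext_entries (by simp [h₅]) (by simp [h₃]) (by simp [h₄])
      (by simp [h₆]))
  have mAD := card_mul_card_le (inf_le_left : A ≤ H) (inf_le_left : D ≤ H)
  have mAS := card_mul_card_le (inf_le_left : A ≤ H) (inf_le_left : S ≤ H)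
  have mDS := card_mul_card_le (inf_le_left : D ≤ H) (inf_le_left : S ≤ H)
  have hu := ncard_union_add_card_inf A D
  rw [hAD] at mAD hu
  rw [hAS] at mAS
  rw [hDS] at mDS
  -- Two antidiagonal elements of determinant -1 have a diagonal product of determinant 1, so
  -- translation by one of them embeds all of them in S.
  have hT : (eigOne G \ splitCartan ℓ).ncard ≤ Nat.card S := by
    rcases (eigOne G \ splitCartan ℓ).eq_empty_or_nonempty with h | ⟨w, ⟨hw, hw'⟩, hw''⟩
    · simp [h]
    · refine Set.ncard_le_ncard_of_injOn (fun x => w * x) ?_ (mul_right_injective w).injOn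
        (t := (S : Set (GL2 ℓ)))
      rintro x ⟨⟨hx, hx'⟩, hx''⟩
      refine ⟨⟨G.mul_mem hw hx,
        mul_mem_splitCartan_of_antidiagonal (hG hw) hw'' (hG hx) hx''⟩, MonoidHom.mem_ker.2 ?_⟩
      rw [map_mul, det_eq_neg_one_of_antidiagonal (hG hw) hw'' hw',
        det_eq_neg_one_of_antidiagonal (hG hx) hx'' hx']
      simp
  have hsub : eigOne G ⊆ (A ∪ D : Set (GL2 ℓ)) ∪ (eigOne G \ splitCartan ℓ) := by
    rintro x ⟨hx, hx'⟩
    by_cases h : x ∈ splitCartan ℓ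
    · left
      have hb := (mem_splitCartan_iff.1 h).2
      rcases (mem_eigOneSet_of_borel hb).1 hx' with h₁ | h₁
      · exact Or.inl ⟨⟨hx, h⟩, mem_borelKer_iff.2 ⟨hb, h₁⟩⟩
      · exact Or.inr ⟨⟨hx, h⟩, mem_borelKer_iff.2 ⟨hb, h₁⟩⟩
    · exact Or.inr ⟨⟨hx, hx'⟩, h⟩
  have hc := (Set.ncard_le_ncard hsub).trans (Set.ncard_union_le _ _)
  have pA : 0 < Nat.card A := Nat.card_pos
  have pD : 0 < Nat.card D := Nat.card_pos
  have pS : 0 < Nat.card S := Nat.card_pos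
  generalize Nat.card A = a at *
  generalize Nat.card D = d at *
  generalize Nat.card S = s at *
  generalize Nat.card H = h at *
  -- Pairwise products of a, d, s are at most h. If s = 1, use (a - 1)(d - 1) ≥ 0; otherwise the
  -- bounds on as and ds suffice.
  have key : a + d + s ≤ h + 2 := by
    obtain ⟨a, rfl⟩ := Nat.exists_eq_add_of_le' pA
    obtain ⟨d, rfl⟩ := Nat.exists_eq_add_of_le' pD
    rcases (show s = 1 ∨ 2 ≤ s by omega) with rfl | hs
    · nlinarith [Nat.zero_le (a * d)]
    · obtain ⟨s, rfl⟩ := Nat.exists_eq_add_of_le' hs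
      nlinarith [Nat.zero_le (a * s), Nat.zero_le (d * s)]
  omega

theorem F1_le_of_conjInto_splitCartanNormalizer {G : Subgroup (GL2 ℓ)}
    (hG : ConjInto G (splitCartanNormalizer ℓ)) (hG' : ¬ ConjInto G (splitCartan ℓ)) :
    F1 G ≤ 1 / 2 + 1 / (Nat.card G : ℚ) := by
  obtain ⟨g, hg⟩ := hG
  have := ncard_eigOne_of_le_splitCartanNormalizer hg fun h => hG' ⟨g, h⟩
  rw [← F1_map_conj G g, ← card_map_conj G g]
  exact_mod_cast F1_le_half_add (k := 1) this

/-! ### The bound 3/4: determinant-one elements -/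

/-- The elements of `G` of determinant `1`. -/
def specialPart (G : Subgroup (GL2 ℓ)) : Subgroup (GL2 ℓ) :=
  G ⊓ (GeneralLinearGroup.det (n := Fin 2) (R := ZMod ℓ)).ker

theorem mem_specialPart {G : Subgroup (GL2 ℓ)} {g : GL2 ℓ} :
    g ∈ specialPart G ↔ g ∈ G ∧ (g : Matrix (Fin 2) (Fin 2) (ZMod ℓ)).det = 1 := by
  rw [specialPart, Subgroup.mem_inf, MonoidHom.mem_ker, Units.ext_iff,
    GeneralLinearGroup.val_det_apply, Units.val_one]

theorem ncard_det_fibre_le (G : Subgroup (GL2 ℓ)) (c : ZMod ℓ) :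
    {g | g ∈ G ∧ (g : Matrix (Fin 2) (Fin 2) (ZMod ℓ)).det = c}.ncard ≤
      Nat.card (specialPart G) := by
  rcases {g | g ∈ G ∧ (g : Matrix (Fin 2) (Fin 2) (ZMod ℓ)).det = c}.eq_empty_or_nonempty with
    h | ⟨w, hw, hwc⟩
  · simp [h]
  · refine Set.ncard_le_ncard_of_injOn (fun x => w⁻¹ * x) ?_ (mul_right_injective w⁻¹).injOn
      (t := (specialPart G : Set (GL2 ℓ)))
    rintro x ⟨hx, hxc⟩
    refine ⟨G.mul_mem (G.inv_mem hw) hx, MonoidHom.mem_ker.2 ?_⟩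
    rw [map_mul, map_inv, inv_mul_eq_one]
    ext
    simp [hwc, hxc]

theorem two_ne_zero' (hℓ : Odd ℓ) : (2 : ZMod ℓ) ≠ 0 := by
  have : Fact (2 < ℓ) := ⟨lt_of_le_of_ne (Fact.out : ℓ.Prime).two_le
    fun h => by rw [← h] at hℓ; exact absurd hℓ (by decide)⟩
  intro h
  apply ZMod.neg_one_ne_one (n := ℓ)
  linear_combination -h

theorem neg_one_ne_one' (hℓ : Odd ℓ) : (-1 : ZMod ℓ) ≠ 1 := fun h =>
  two_ne_zero' hℓ (by linear_combination -h)

theorem two_mul_card_specialPart_le (hℓ : Odd ℓ) {G : Subgroup (GL2 ℓ)} {y : GL2 ℓ} (hy : y ∈ G)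
    (hdet : (y : Matrix (Fin 2) (Fin 2) (ZMod ℓ)).det = -1) :
    2 * Nat.card (specialPart G) ≤ Nat.card G :=
  two_mul_card_le_of_not_le inf_le_left fun h => neg_one_ne_one' hℓ (by
    rw [← hdet]; exact (mem_specialPart.1 (h hy)).2)

/-- If both x and -x have eigenvalue 1, then 2(1 + det x) = 0. So X ∩ -X lies in the fibre of
determinant -1, which is at most half of G; but |X| > 3|G|/4 would force the intersection above
half. -/
theorem ncard_eigOne_of_neg_one_mem (hℓ : Odd ℓ) {G : Subgroup (GL2 ℓ)} (hG : -1 ∈ G) :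
    4 * (eigOne G).ncard ≤ 3 * Nat.card G := by
  by_contra! hlt
  have hneg : (Neg.neg '' eigOne G).ncard = (eigOne G).ncard :=
    Set.ncard_image_of_injective _ neg_injective
  have hT : Neg.neg '' eigOne G ⊆ G := by
    rintro _ ⟨x, hx, rfl⟩
    simpa using G.mul_mem hG hx.1
  have hsub : eigOne G ∩ Neg.neg '' eigOne G ⊆
      {g | g ∈ G ∧ (g : Matrix (Fin 2) (Fin 2) (ZMod ℓ)).det = -1} := by
    rintro _ ⟨hx, y, hy, rfl⟩
    refine ⟨hx.1, ?_⟩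
    have h₁ := (mem_eigOne.1 hx).2
    have h₂ := (mem_eigOne.1 hy).2
    rw [Units.val_neg, trace_neg, Matrix.det_neg, Fintype.card_fin] at h₁
    rw [Units.val_neg, Matrix.det_neg, Fintype.card_fin]
    refine mul_left_cancel₀ (two_ne_zero' hℓ) ?_
    linear_combination -h₁ - h₂
  have hcard : (G : Set (GL2 ℓ)).ncard = Nat.card G := rfl
  have h₁ : Nat.card G / 2 < (eigOne G ∩ Neg.neg '' eigOne G).ncard :=
    lt_ncard_inter (K := (G : Set (GL2 ℓ))) Set.inter_subset_left hT (by omega) hneg.ge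
  obtain ⟨y, hy⟩ : (eigOne G ∩ Neg.neg '' eigOne G).Nonempty :=
    Set.nonempty_of_ncard_ne_zero (by omega)
  have h₂ := (Set.ncard_le_ncard hsub).trans (ncard_det_fibre_le G (-1))
  have h₃ := two_mul_card_specialPart_le hℓ (hsub hy).1 (hsub hy).2
  omega

/-- Cayley–Hamilton for determinant 1: h + h⁻¹ is the scalar tr h. -/
theorem trace_mul_add_trace_mul_inv {y h : GL2 ℓ}
    (hh : (h : Matrix (Fin 2) (Fin 2) (ZMod ℓ)).det = 1) :
    ((y * h : GL2 ℓ) : Matrix (Fin 2) (Fin 2) (ZMod ℓ)).trace +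
      ((y * h⁻¹ : GL2 ℓ) : Matrix (Fin 2) (Fin 2) (ZMod ℓ)).trace =
    (h : Matrix (Fin 2) (Fin 2) (ZMod ℓ)).trace * (y : Matrix (Fin 2) (Fin 2) (ZMod ℓ)).trace := by
  have hinv : ((h⁻¹ : GL2 ℓ) : Matrix (Fin 2) (Fin 2) (ZMod ℓ)) =
      !![h 1 1, -h 0 1; -h 1 0, h 0 0] := by
    rw [coe_units_inv, inv_def, hh, adjugate_fin_two]
    simp
  rw [Units.val_mul, Units.val_mul, hinv]
  simp only [trace_fin_two, Matrix.mul_apply, Fin.sum_univ_two, of_apply, cons_val', cons_val_zero,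
    cons_val_one, cons_val_fin_one]
  ring

/-- For 1 ≠ h of determinant 1, having y, yh and yh⁻¹ all in X forces (tr h - 2)(1 + det y) = 0,
hence det y = -1. If |X| > 3|G|/4, more than a quarter of G consists of such y, leaving only index 2
for the determinant-one subgroup. -/
theorem ncard_eigOne_of_semisimple (hℓ : Odd ℓ) {G : Subgroup (GL2 ℓ)}
    (hne : specialPart G ≠ ⊥)
    (huni : ∀ u ∈ specialPart G, (u : Matrix (Fin 2) (Fin 2) (ZMod ℓ)).trace = 2 → u = 1) :
    4 * (eigOne G).ncard ≤ 3 * Nat.card G := by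
  by_contra! hlt
  obtain ⟨⟨h, hh⟩, hh'⟩ := Subgroup.ne_bot_iff_exists_ne_one.1 hne
  have hh1 : h ≠ 1 := fun e => hh' (Subtype.ext e)
  obtain ⟨hhG, hhdet⟩ := mem_specialPart.1 hh
  have hcard : (G : Set (GL2 ℓ)).ncard = Nat.card G := rfl
  have htr : ∀ k ∈ G, ((fun x => x * k) '' eigOne G).ncard = (eigOne G).ncard ∧
      (fun x => x * k) '' eigOne G ⊆ G := by
    refine fun k hk => ⟨Set.ncard_image_of_injective _ (mul_left_injective k), ?_⟩
    rintro _ ⟨x, hx, rfl⟩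
    exact G.mul_mem hx.1 hk
  set S := (fun x => x * h) '' eigOne G with hS
  set T := (fun x => x * h⁻¹) '' eigOne G with hT
  have hS' := htr h hhG
  have hT' := htr h⁻¹ (G.inv_mem hhG)
  have h₁ : Nat.card G / 2 < (eigOne G ∩ S).ncard :=
    lt_ncard_inter (K := (G : Set (GL2 ℓ))) Set.inter_subset_left hS'.2 (by omega) hS'.1.ge
  have h₂ : Nat.card G / 4 < (eigOne G ∩ S ∩ T).ncard :=
    lt_ncard_inter (K := (G : Set (GL2 ℓ)))
      (Set.inter_subset_left.trans Set.inter_subset_left) hT'.2 (by omega) hT'.1.ge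
  have hsub : eigOne G ∩ S ∩ T ⊆
      {g | g ∈ G ∧ (g : Matrix (Fin 2) (Fin 2) (ZMod ℓ)).det = -1} := by
    rintro y ⟨⟨hy, x, hx, hxy⟩, z, hz, hzy⟩
    refine ⟨hy.1, ?_⟩
    obtain rfl : x = y * h⁻¹ := by rw [← hxy]; simp
    obtain rfl : z = y * h := by rw [← hzy]; simp
    have hdet : ((h⁻¹ : GL2 ℓ) : Matrix (Fin 2) (Fin 2) (ZMod ℓ)).det = 1 :=
      (mem_specialPart.1 (inv_mem hh)).2
    have e₁ := (mem_eigOne.1 hy).2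
    have e₂ := (mem_eigOne.1 hx).2
    have e₃ := (mem_eigOne.1 hz).2
    have e₄ := trace_mul_add_trace_mul_inv (y := y) hhdet
    rw [e₁, e₂, e₃, Units.val_mul, Units.val_mul, det_mul, det_mul, hhdet, hdet] at e₄
    have e₅ : (h : Matrix (Fin 2) (Fin 2) (ZMod ℓ)).trace - 2 ≠ 0 := fun e =>
      hh1 (huni h hh (sub_eq_zero.1 e))
    refine mul_left_cancel₀ e₅ ?_
    linear_combination -e₄
  obtain ⟨y, hy⟩ : (eigOne G ∩ S ∩ T).Nonempty := Set.nonempty_of_ncard_ne_zero (by omega)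
  obtain ⟨hyG, hydet⟩ := hsub hy
  have h₃ := (Set.ncard_le_ncard hsub).trans (ncard_det_fibre_le G (-1))
  have hindex : Nat.card (specialPart G) *
      Nat.card (G.map (GeneralLinearGroup.det (n := Fin 2) (R := ZMod ℓ))) = Nat.card G := by
    rw [← Subgroup.relIndex_ker, ← Subgroup.inf_relIndex_left]
    exact card_mul_relIndex_of_le inf_le_left
  have heven : 2 ∣ Nat.card (G.map (GeneralLinearGroup.det (n := Fin 2) (R := ZMod ℓ))) := by
    have hmem : (-1 : (ZMod ℓ)ˣ) ∈ G.map (GeneralLinearGroup.det (n := Fin 2) (R := ZMod ℓ)) :=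
      ⟨y, hyG, by ext; simp [hydet]⟩
    have hord : orderOf (-1 : (ZMod ℓ)ˣ) = 2 := by
      refine orderOf_eq_prime (by simp) fun e => neg_one_ne_one' hℓ ?_
      simpa using congrArg Units.val e
    exact hord.symm.dvd.trans (Subgroup.orderOf_dvd_natCard _ hmem)
  have hpos : 0 < Nat.card (specialPart G) := Nat.card_pos
  have hGpos : 0 < Nat.card G := Nat.card_pos
  obtain ⟨m, hm⟩ := heven
  rw [hm] at hindex
  -- The index 2m is even since -1 is a determinant, and below 4 since a fibre of the determinant
  -- exceeds |G|/4.
  have hm1 : m = 1 := by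
    rcases m with _ | _ | m
    · omega
    · rfl
    · exfalso
      have : 4 * Nat.card (specialPart G) ≤ Nat.card G := by rw [← hindex]; nlinarith
      omega
  have htwo : 2 ≤ Nat.card (specialPart G) := by
    have := (Subgroup.card_eq_one (H := specialPart G)).not.2 hne
    omega
  -- Determinant one and eigenvalue 1 give trace 2, so only the identity survives in that half; thus
  -- |X| ≤ 1 + |G|/2 with |G| ≥ 4.
  have hX : eigOne G ⊆ {1} ∪ ((G : Set (GL2 ℓ)) \ specialPart G) := by
    intro x hx
    by_cases hxs : x ∈ specialPart G
    · left
      refine huni x hxs ?_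
      rw [(mem_eigOne.1 hx).2, (mem_specialPart.1 hxs).2]
      norm_num
    · exact Or.inr ⟨hx.1, hxs⟩
  have h₄ := (Set.ncard_le_ncard hX).trans (Set.ncard_union_le _ _)
  have h₅ : ((G : Set (GL2 ℓ)) \ specialPart G).ncard + Nat.card (specialPart G) = Nat.card G :=
    Set.ncard_sdiff_add_ncard_of_subset (s := (specialPart G : Set (GL2 ℓ))) fun x hx => hx.1
  rw [Set.ncard_singleton] at h₄
  subst hm1
  omega

/-! ### The bound 3/4: stable lines and unipotents -/

theorem exists_conj_mem_borel {v : Fin 2 → ZMod ℓ} (hv : v ≠ 0) :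
    ∃ g : GL2 ℓ, ∀ x : GL2 ℓ,
      (∃ a : ZMod ℓ, (x : Matrix (Fin 2) (Fin 2) (ZMod ℓ)) *ᵥ v = a • v) →
        MulAut.conj g x ∈ borel ℓ := by
  obtain ⟨P, hP⟩ : ∃ P : GL2 ℓ,
      (P : Matrix (Fin 2) (Fin 2) (ZMod ℓ)) *ᵥ (Pi.single 0 1) = v := by
    by_cases h₀ : v 0 = 0
    · have h₁ : v 1 ≠ 0 := fun h₁ => hv (by ext i; fin_cases i <;> assumption)
      refine ⟨GeneralLinearGroup.mkOfDetNeZero !![v 0, 1; v 1, 0] (by simpa [det_fin_two] using h₁),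
        ?_⟩
      ext i
      fin_cases i <;> simp [GeneralLinearGroup.mkOfDetNeZero]
    · refine ⟨GeneralLinearGroup.mkOfDetNeZero !![v 0, 0; v 1, 1] (by simpa [det_fin_two] using h₀),
        ?_⟩
      ext i
      fin_cases i <;> simp [GeneralLinearGroup.mkOfDetNeZero]
  refine ⟨P⁻¹, ?_⟩
  rintro x ⟨a, ha⟩
  rw [mem_borel_iff, MulAut.conj_apply, inv_inv]
  have hPv : ((P⁻¹ : GL2 ℓ) : Matrix (Fin 2) (Fin 2) (ZMod ℓ)) *ᵥ v = Pi.single 0 1 := by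
    rw [← hP, mulVec_mulVec, ← Units.val_mul, inv_mul_cancel, Units.val_one, one_mulVec]
  have key : ((P⁻¹ * x * P : GL2 ℓ) : Matrix (Fin 2) (Fin 2) (ZMod ℓ)) *ᵥ (Pi.single 0 1) =
      a • Pi.single 0 1 := by
    rw [Units.val_mul, Units.val_mul, ← mulVec_mulVec, hP, ← mulVec_mulVec, ha, mulVec_smul, hPv]
  have := congrFun key 1
  simpa [-Units.val_mul] using this

theorem conjInto_borel_of_eigenvector {G : Subgroup (GL2 ℓ)} {v : Fin 2 → ZMod ℓ} (hv : v ≠ 0)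
    (h : ∀ x ∈ G, ∃ a : ZMod ℓ, (x : Matrix (Fin 2) (Fin 2) (ZMod ℓ)) *ᵥ v = a • v) :
    ConjInto G (borel ℓ) := by
  obtain ⟨g, hg⟩ := exists_conj_mem_borel hv
  refine ⟨g, ?_⟩
  rintro _ ⟨x, hx, rfl⟩
  exact hg x (h x hx)

theorem exists_fixed_vector {x : GL2 ℓ} (hx : x ∈ eigOneSet ℓ) :
    ∃ v : Fin 2 → ZMod ℓ, v ≠ 0 ∧ (x : Matrix (Fin 2) (Fin 2) (ZMod ℓ)) *ᵥ v = v := by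
  obtain ⟨v, hv⟩ := Module.End.HasEigenvalue.exists_hasEigenvector hx
  exact ⟨v, hv.2, by simpa using hv.apply_eq_smul⟩

/-- Two independent fixed vectors would form a basis and force x = 1; by Cramer's rule, det(v, w)
annihilates x - 1. -/
theorem eq_smul_of_fixed {x : GL2 ℓ} (hx : x ≠ 1) {v w : Fin 2 → ZMod ℓ} (hv : v ≠ 0)
    (hxv : (x : Matrix (Fin 2) (Fin 2) (ZMod ℓ)) *ᵥ v = v)
    (hxw : (x : Matrix (Fin 2) (Fin 2) (ZMod ℓ)) *ᵥ w = w) : ∃ a : ZMod ℓ, w = a • v := by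
  have v₀ := congrFun hxv 0
  have v₁ := congrFun hxv 1
  have w₀ := congrFun hxw 0
  have w₁ := congrFun hxw 1
  simp only [mulVec, dotProduct, Fin.sum_univ_two] at v₀ v₁ w₀ w₁
  have hd : v 0 * w 1 - v 1 * w 0 = 0 := by
    by_contra hd
    refine hx (ext_entries ?_ ?_ ?_ ?_) <;> refine mul_left_cancel₀ hd ?_ <;>
      simp only [Units.val_one, one_apply_eq, one_apply_ne, ne_eq, zero_ne_one, one_ne_zero,
        not_false_eq_true]
    · linear_combination w 1 * v₀ - v 1 * w₀
    · linear_combination v 0 * w₀ - w 0 * v₀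
    · linear_combination w 1 * v₁ - v 1 * w₁
    · linear_combination v 0 * w₁ - w 0 * v₁
  by_cases h₀ : v 0 = 0
  · have h₁ : v 1 ≠ 0 := fun h₁ => hv (by ext i; fin_cases i <;> assumption)
    refine ⟨w 1 / v 1, ?_⟩
    ext i
    fin_cases i <;> simp <;> field_simp
    linear_combination -hd
  · refine ⟨w 0 / v 0, ?_⟩
    ext i
    fin_cases i <;> simp <;> field_simp
    linear_combination hd

/-- Commutators have determinant 1, so G is abelian and preserves the fixed line of any nontrivial
element with eigenvalue 1. -/
theorem F1_le_of_specialPart_eq_bot {G : Subgroup (GL2 ℓ)} (hG : specialPart G = ⊥)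
    (h : F1 G ≠ 1) : F1 G ≤ 3 / 4 := by
  have hcomm : ∀ x ∈ G, ∀ y ∈ G, x * y = y * x := by
    intro x hx y hy
    have : x * y * (y * x)⁻¹ ∈ specialPart G := by
      refine ⟨G.mul_mem (G.mul_mem hx hy) (G.inv_mem (G.mul_mem hy hx)), MonoidHom.mem_ker.2 ?_⟩
      rw [map_mul, map_inv, map_mul, map_mul, mul_comm, mul_comm (GeneralLinearGroup.det y),
        inv_mul_cancel]
    rw [hG, Subgroup.mem_bot, mul_inv_eq_one] at this
    exact this
  by_cases hX : eigOne G ⊆ {1}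
  · have hone : G ≠ ⊥ := by
      rintro rfl
      refine F1_ne_one_iff.1 h (Set.Subset.antisymm Set.inter_subset_left ?_)
      rintro _ rfl
      refine mem_eigOne.2 ⟨rfl, ?_⟩
      simp
      norm_num
    have h₁ := (Subgroup.card_eq_one (H := G)).not.2 hone
    have h₂ := Set.ncard_le_ncard hX
    have h₃ : 0 < Nat.card G := Nat.card_pos
    rw [Set.ncard_singleton] at h₂
    exact F1_le_three_quarters_iff.2 (by omega)
  · obtain ⟨x, hx, hx1⟩ := Set.not_subset.1 hX
    obtain ⟨v, hv, hxv⟩ := exists_fixed_vector hx.2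
    refine (F1_le_of_conjInto_borel (conjInto_borel_of_eigenvector hv fun g hg => ?_) h).2
    refine eq_smul_of_fixed hx1 hv hxv ?_
    rw [mulVec_mulVec, ← Units.val_mul, hcomm x hx.1 g hg, Units.val_mul, ← mulVec_mulVec, hxv]

theorem mul_self_eq_neg_one {w : GL2 ℓ} (htr : (w : Matrix (Fin 2) (Fin 2) (ZMod ℓ)).trace = 0)
    (hdet : (w : Matrix (Fin 2) (Fin 2) (ZMod ℓ)).det = 1) : w * w = -1 := by
  rw [trace_fin_two] at htr
  rw [det_eq] at hdet
  apply ext_entries <;> simp [Matrix.mul_apply, Fin.sum_univ_two]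
  · linear_combination w 0 0 * htr - hdet
  · linear_combination w 0 1 * htr
  · linear_combination w 1 0 * htr
  · linear_combination w 1 1 * htr - hdet

theorem unipotent_pow {u : GL2 ℓ} {b : ZMod ℓ}
    (hu : (u : Matrix (Fin 2) (Fin 2) (ZMod ℓ)) = !![1, b; 0, 1]) (k : ℕ) :
    ((u ^ k : GL2 ℓ) : Matrix (Fin 2) (Fin 2) (ZMod ℓ)) = !![1, k * b; 0, 1] := by
  induction k with
  | zero => simp [one_fin_two]
  | succ k ih =>
    rw [pow_succ, Units.val_mul, ih, hu, mul_fin_two]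
    congr! 3 <;> push_cast <;> ring_nf

/-- A conjugate v of a power of u can be chosen so that uvu has trace 0 and determinant 1; its
square is then -1. -/
theorem neg_one_mem_of_unipotent {G : Subgroup (GL2 ℓ)} {u g : GL2 ℓ} (hu : u ∈ G) (hg : g ∈ G)
    {b : ZMod ℓ} (hb : b ≠ 0) (hub : (u : Matrix (Fin 2) (Fin 2) (ZMod ℓ)) = !![1, b; 0, 1])
    (hg10 : g 1 0 ≠ 0) : -1 ∈ G := by
  set δ := (g : Matrix (Fin 2) (Fin 2) (ZMod ℓ)).det with hδ
  have hδ0 : δ ≠ 0 := det_ne_zero' g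
  -- The lower left entry of v is -k b (g 1 0)² / δ; this k makes b times it equal to -1, so that
  -- tr(uvu) = tr v + 2b(v 1 0) = 0.
  set k : ℕ := (δ / (b ^ 2 * g 1 0 ^ 2)).val with hk
  have hkc : (k : ZMod ℓ) = δ / (b ^ 2 * g 1 0 ^ 2) := ZMod.natCast_zmod_val _
  set v := g * u ^ k * g⁻¹ with hv
  have hpow := unipotent_pow hub k
  have hvtr : (v : Matrix (Fin 2) (Fin 2) (ZMod ℓ)).trace = 2 := by
    rw [hv, trace_conj, hpow, trace_fin_two]
    simp
    norm_num
  have hvdet : (v : Matrix (Fin 2) (Fin 2) (ZMod ℓ)).det = 1 := by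
    rw [hv, det_conj, hpow, det_fin_two]
    simp
  have hv10 : b * v 1 0 = -1 := by
    have hvg : (v : Matrix (Fin 2) (Fin 2) (ZMod ℓ)) * (g : Matrix (Fin 2) (Fin 2) (ZMod ℓ)) =
        (g : Matrix (Fin 2) (Fin 2) (ZMod ℓ)) * !![1, k * b; 0, 1] := by
      rw [← hpow, ← Units.val_mul, ← Units.val_mul, hv, inv_mul_cancel_right]
    have e₀ := congrFun (congrFun hvg 1) 0
    have e₁ := congrFun (congrFun hvg 1) 1
    simp [Matrix.mul_apply, Fin.sum_univ_two] at e₀ e₁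
    rw [det_eq] at hδ
    have e₂ : δ * v 1 0 = -(g 1 0 ^ 2 * (k * b)) := by
      rw [hδ]
      linear_combination g 1 1 * e₀ - g 1 0 * e₁
    rw [hkc] at e₂
    field_simp at e₂
    rw [mul_comm, e₂]
  have hw : u * v * u ∈ G := G.mul_mem (G.mul_mem hu
    (G.mul_mem (G.mul_mem hg (G.pow_mem hu k)) (G.inv_mem hg))) hu
  have hww : u * v * u * (u * v * u) = -1 := by
    refine mul_self_eq_neg_one ?_ ?_
    · rw [trace_fin_two] at hvtr
      rw [Units.val_mul, Units.val_mul, hub, trace_fin_two]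
      simp [Matrix.mul_apply, Fin.sum_univ_two, Matrix.vecMul, dotProduct]
      linear_combination hvtr + 2 * hv10
    · rw [Units.val_mul, Units.val_mul, det_mul, det_mul, hvdet, hub, det_fin_two]
      simp
  rw [← hww]
  exact G.mul_mem hw hw

theorem F1_le_of_unipotent (hℓ : Odd ℓ) {G : Subgroup (GL2 ℓ)} {u : GL2 ℓ}
    (hu : u ∈ specialPart G) (htr : (u : Matrix (Fin 2) (Fin 2) (ZMod ℓ)).trace = 2) (hu1 : u ≠ 1)
    (h : F1 G ≠ 1) : F1 G ≤ 3 / 4 := by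
  obtain ⟨huG, hdet⟩ := mem_specialPart.1 hu
  obtain ⟨v, hv, huv⟩ := exists_fixed_vector (x := u) (mem_eigOneSet_iff.2 (by
    rw [htr, hdet]; norm_num))
  obtain ⟨P, hP⟩ := exists_conj_mem_borel hv
  have hub := mem_borel_iff.1 (hP u ⟨1, by rw [huv, one_smul]⟩)
  have hne : MulAut.conj P u ≠ 1 := by simpa using hu1
  have hmem : MulAut.conj P u ∈ G.map (MulAut.conj P).toMonoidHom := ⟨u, huG, rfl⟩
  rw [← trace_conj P, ← MulAut.conj_apply, trace_fin_two] at htr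
  rw [← det_conj P, ← MulAut.conj_apply, det_eq, hub] at hdet
  set u' := MulAut.conj P u with hu'
  -- Trace 2 and determinant 1 make 1 a double root of the characteristic polynomial.
  have h₀₀ : u' 0 0 = 1 := by
    have : (u' 0 0 - 1) ^ 2 = 0 := by linear_combination u' 0 0 * htr - hdet
    exact sub_eq_zero.1 (pow_eq_zero_iff two_ne_zero |>.1 this)
  have h₁₁ : u' 1 1 = 1 := by linear_combination htr - h₀₀
  have h₀₁ : u' 0 1 ≠ 0 := fun h₀₁ =>
    hne (ext_entries (by simp [h₀₀]) (by simp [h₀₁]) (by simp [hub]) (by simp [h₁₁]))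
  have hmat : (u' : Matrix (Fin 2) (Fin 2) (ZMod ℓ)) = !![1, u' 0 1; 0, 1] := by
    conv_lhs => rw [eta_fin_two (u' : Matrix (Fin 2) (Fin 2) (ZMod ℓ)), h₀₀, hub, h₁₁]
  by_cases hB : G.map (MulAut.conj P).toMonoidHom ≤ borel ℓ
  · exact (F1_le_of_conjInto_borel ⟨P, hB⟩ h).2
  · obtain ⟨g, hg, hg'⟩ := Set.not_subset.1 hB
    rw [← F1_map_conj G P]
    exact F1_le_three_quarters_iff.2 (ncard_eigOne_of_neg_one_mem hℓ
      (neg_one_mem_of_unipotent hmem hg h₀₁ hmat fun e => hg' (mem_borel_iff.2 e)))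

theorem F1_le_three_quarters (hℓ : Odd ℓ) {G : Subgroup (GL2 ℓ)} (h : F1 G ≠ 1) :
    F1 G ≤ 3 / 4 := by
  by_cases hG : specialPart G = ⊥
  · exact F1_le_of_specialPart_eq_bot hG h
  by_cases huni : ∀ u ∈ specialPart G,
      (u : Matrix (Fin 2) (Fin 2) (ZMod ℓ)).trace = 2 → u = 1
  · exact F1_le_three_quarters_iff.2 (ncard_eigOne_of_semisimple hℓ hG huni)
  · push Not at huni
    obtain ⟨u, hu, htr, hu1⟩ := huni
    exact F1_le_of_unipotent hℓ hu htr hu1 h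

end EigOne

theorem mainTheorem4 (ℓ : ℕ) [Fact ℓ.Prime] (hℓ : Odd ℓ) (G : Subgroup (EigOne.GL2 ℓ))
    (hG : EigOne.F1 G ≠ 1) :
    (EigOne.IsTypeCs G → EigOne.F1 G ≤ 1 / 2 + 1 / (Nat.card G : ℚ)) ∧
    (∀ ε : ZMod ℓ, ¬ IsSquare ε → EigOne.IsTypeNs ε G →
      EigOne.F1 G ≤ 1 / 2 + 1 / (Nat.card G : ℚ)) ∧
    (EigOne.IsTypeB G → EigOne.F1 G ≤ 1 / 2 + (ℓ : ℚ) / (Nat.card G : ℚ)) ∧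
    (EigOne.IsTypeA4 G ∨ EigOne.IsTypeS4 G ∨ EigOne.IsTypeA5 G → EigOne.F1 G ≤ 3 / 4) ∧
    EigOne.F1 G ≤ 3 / 4 :=
  ⟨fun h => EigOne.F1_le_of_conjInto_splitCartan h.2 hG,
    fun _ _ h => EigOne.F1_le_of_conjInto_splitCartanNormalizer h.2.1 h.2.2.1,
    fun h => (EigOne.F1_le_of_conjInto_borel h.2.1 hG).1,
    fun _ => EigOne.F1_le_three_quarters hℓ hG, EigOne.F1_le_three_quarters hℓ hG⟩
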